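/- Let $\Lambda$ be a lattice in $\mathbb{R}^d$, that is, a discrete subgroup spanning $\mathbb{R}^d$ over $\mathbb{R}$, and suppose that $\Lambda$ is rational, i.e. there is a real $c>0$ with $c\langle x,y\rangle\in\mathbb{Q}$ for all $x,y\in\Lambda$. Then $\Lambda$ has a well-rounded sublattice: there is a lattice $\Gamma$ in $\mathbb{R}^d$ with $\Gamma\subseteq\Lambda$ whose non-zero vectors of minimal length span $\mathbb{R}^d$. Moreover, for every non-zero $v\in\Lambda$, the reflection $R_v\colon x\mapsto x-2\frac{\langle x,v\rangle}{\langle v,v\rangle}v$ is a coincidence isometry of $\Lambda$, i.e. $R_v\in OC(\Lambda)$, where $OC(\Lambda)$ is the set of all $R\in O(d)$ such that $\Lambda\cap R\Lambda$ is a sublattice of full rank in $\Lambda$. -/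

import Mathlib

/-- `Λ` is a (full-rank) lattice in `ℝ^d`: a discrete subgroup that spans `ℝ^d` over `ℝ`. -/
def IsLatticeIn (d : ℕ) (Λ : Submodule ℤ (EuclideanSpace ℝ (Fin d))) : Prop :=
  ∃ _ : DiscreteTopology Λ, IsZLattice ℝ Λ

/-- A lattice is rational if its Gram matrix is rational up to a common positive factor: some
positive multiple of the inner product takes rational values on the lattice. -/
def IsRationalLattice (d : ℕ) (Λ : Submodule ℤ (EuclideanSpace ℝ (Fin d))) : Prop :=
  ∃ c : ℝ, 0 < c ∧ ∀ x ∈ Λ, ∀ y ∈ Λ, ∃ q : ℚ, c * inner ℝ x y = (q : ℝ)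

/-- The non-zero vectors of `Λ` of minimal length. -/
def minimalVectors (d : ℕ) (Λ : Submodule ℤ (EuclideanSpace ℝ (Fin d))) :
    Set (EuclideanSpace ℝ (Fin d)) :=
  {v | v ∈ Λ ∧ v ≠ 0 ∧ ∀ w ∈ Λ, w ≠ 0 → ‖v‖ ≤ ‖w‖}

/-- `Λ` is well-rounded: its non-zero vectors of minimal length span `ℝ^d`. -/
def IsWellRounded (d : ℕ) (Λ : Submodule ℤ (EuclideanSpace ℝ (Fin d))) : Prop :=
  Submodule.span ℝ (minimalVectors d Λ) = ⊤

/-- The intersection `Λ(R) = Λ ∩ RΛ` for an isometry `R ∈ O(d)`. -/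
noncomputable def coincidenceSite (d : ℕ) (Λ : Submodule ℤ (EuclideanSpace ℝ (Fin d)))
    (R : EuclideanSpace ℝ (Fin d) ≃ₗᵢ[ℝ] EuclideanSpace ℝ (Fin d)) :
    Submodule ℤ (EuclideanSpace ℝ (Fin d)) :=
  Λ ⊓ Λ.map ((R.toLinearEquiv : EuclideanSpace ℝ (Fin d) →ₗ[ℝ]
    EuclideanSpace ℝ (Fin d)).restrictScalars ℤ)

/-- `OC(Λ)`: the isometries `R ∈ O(d)` such that `Λ ∩ RΛ` is a sublattice of full rank. -/
def coincidenceIsometries (d : ℕ) (Λ : Submodule ℤ (EuclideanSpace ℝ (Fin d))) :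
    Set (EuclideanSpace ℝ (Fin d) ≃ₗᵢ[ℝ] EuclideanSpace ℝ (Fin d)) :=
  {R | IsLatticeIn d (coincidenceSite d Λ R)}

/-- The reflection generated by `v`: the orthogonal reflection in the hyperplane `v^⊥`,
i.e. `x ↦ x - 2 (⟪v, x⟫ / ⟪v, v⟫) v` for `v ≠ 0`. -/
noncomputable def reflectionOf (d : ℕ) (v : EuclideanSpace ℝ (Fin d)) :
    EuclideanSpace ℝ (Fin d) ≃ₗᵢ[ℝ] EuclideanSpace ℝ (Fin d) :=
  (Submodule.span ℝ {v})ᗮ.reflection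

/-! By rationality the coefficient `2⟪v, x⟫/⟪v, v⟫` is rational, so a nonzero multiple of `R_v x`
lies in `Λ`; this gives the coincidence property. For the well-rounded sublattice, fix `v ≠ 0` in
`Λ`. A reflection depends only on the direction of its generator, and lattice directions are dense,
so suitable `w i ∈ Λ` send `v` arbitrarily close to `±‖v‖ e i`. These images share one length and
are almost orthogonal; a common integer multiple lies in `Λ`, and by
`le_norm_sum_zsmul_of_almost_orthogonal` the multiples are shortest vectors of their span. -/

open Filter Topology in
/-- Every vector is a limit of rescaled points of a lattice. -/
theorem exists_tendsto_inv_smul_of_isLatticeIn {d : ℕ}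
    {Λ : Submodule ℤ (EuclideanSpace ℝ (Fin d))} (hΛ : IsLatticeIn d Λ)
    (x : EuclideanSpace ℝ (Fin d)) :
    ∃ l : ℕ → EuclideanSpace ℝ (Fin d), (∀ n, l n ∈ Λ) ∧
      Tendsto (fun n : ℕ => (n : ℝ)⁻¹ • l n) atTop (𝓝 x) := by
  obtain ⟨_, _⟩ := hΛ
  have : Module.Finite ℤ Λ := ZLattice.module_finite ℝ Λ
  have : Module.Free ℤ Λ := ZLattice.module_free ℝ Λ
  let b := (Module.Free.chooseBasis ℤ Λ).ofZLatticeBasis ℝ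
  have hb : Submodule.span ℤ (Set.range b) = Λ :=
    (Module.Free.chooseBasis ℤ Λ).ofZLatticeBasis_span ℝ
  -- The rounding error is at most `∑ i, ‖b i‖`, independent of `n`, so dividing by `n` removes it.
  refine ⟨fun n => ZSpan.floor b ((n : ℝ) • x), fun n => hb.le (ZSpan.floor b _).2, ?_⟩
  rw [tendsto_iff_norm_sub_tendsto_zero]
  have hlim : Tendsto (fun n : ℕ => (n : ℝ)⁻¹ * ∑ i, ‖b i‖) atTop (𝓝 0) := by
    simpa using (tendsto_inv_atTop_nhds_zero_nat (𝕜 := ℝ)).mul_const (∑ i, ‖b i‖)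
  refine squeeze_zero' (Eventually.of_forall fun _ => norm_nonneg _) ?_ hlim
  filter_upwards [eventually_ne_atTop 0] with n hn
  have hn' : (n : ℝ) ≠ 0 := Nat.cast_ne_zero.mpr hn
  have key : (n : ℝ)⁻¹ • (ZSpan.floor b ((n : ℝ) • x) : EuclideanSpace ℝ (Fin d)) - x =
      -((n : ℝ)⁻¹ • ZSpan.fract b ((n : ℝ) • x)) := by
    rw [ZSpan.fract_apply, smul_sub, inv_smul_smul₀ hn']
    abel
  rw [key, norm_neg, norm_smul, norm_inv, Real.norm_natCast]
  gcongr
  exact ZSpan.norm_fract_le b _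

theorem reflectionOf_apply {d : ℕ} (v x : EuclideanSpace ℝ (Fin d)) :
    reflectionOf d v x = x - (2 * (inner ℝ v x / inner ℝ v v)) • v := by
  rw [reflectionOf, Submodule.reflection_orthogonal_apply, Submodule.reflection_singleton_apply,
    real_inner_self_eq_norm_sq, mul_smul]
  simp [two_smul]

theorem reflectionOf_smul {d : ℕ} {a : ℝ} (ha : a ≠ 0) (v x : EuclideanSpace ℝ (Fin d)) :
    reflectionOf d (a • v) x = reflectionOf d v x := by
  have h : Submodule.span ℝ {a • v} = Submodule.span ℝ {v} :=
    Submodule.span_singleton_smul_eq (IsUnit.mk0 a ha) v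
  simp only [reflectionOf, h]

theorem reflectionOf_reflectionOf {d : ℕ} (v x : EuclideanSpace ℝ (Fin d)) :
    reflectionOf d v (reflectionOf d v x) = x :=
  Submodule.reflection_reflection _ x

theorem continuousAt_reflectionOf {d : ℕ} {v : EuclideanSpace ℝ (Fin d)} (hv : v ≠ 0)
    (x : EuclideanSpace ℝ (Fin d)) : ContinuousAt (fun w => reflectionOf d w x) v := by
  simp only [reflectionOf_apply]
  have : inner ℝ v v ≠ 0 := inner_self_ne_zero.mpr hv
  fun_prop (disch := assumption)

/-- The mirror vector `v - u` degenerates when `v = u`; the sign covers this case and does not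
affect orthogonality. -/
theorem exists_reflectionOf_eq_or_neg {d : ℕ} {v u : EuclideanSpace ℝ (Fin d)} (hv : v ≠ 0)
    (h : ‖v‖ = ‖u‖) : ∃ y ≠ 0, reflectionOf d y v = u ∨ reflectionOf d y v = -u := by
  by_cases hvu : v = u
  · exact ⟨v, hv, Or.inr (by
      subst hvu
      exact Submodule.reflection_orthogonalComplement_singleton_eq_neg v)⟩
  · exact ⟨v - u, sub_ne_zero.mpr hvu, Or.inl (Submodule.reflection_sub h)⟩

open Filter Topology in
theorem exists_tendsto_reflectionOf {d : ℕ}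
    {Λ : Submodule ℤ (EuclideanSpace ℝ (Fin d))} (hΛ : IsLatticeIn d Λ)
    {y : EuclideanSpace ℝ (Fin d)} (hy : y ≠ 0) (v : EuclideanSpace ℝ (Fin d)) :
    ∃ l : ℕ → EuclideanSpace ℝ (Fin d), (∀ n, l n ∈ Λ) ∧
      Tendsto (fun n => reflectionOf d (l n) v) atTop (𝓝 (reflectionOf d y v)) := by
  obtain ⟨l, hl, hlim⟩ := exists_tendsto_inv_smul_of_isLatticeIn hΛ y
  refine ⟨l, hl, ((continuousAt_reflectionOf hy v).tendsto.comp hlim).congr' ?_⟩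
  filter_upwards [eventually_ne_atTop 0] with n hn
  exact reflectionOf_smul (inv_ne_zero (Nat.cast_ne_zero.mpr hn)) _ _

theorem IsRationalLattice.exists_smul_reflectionOf_mem {d : ℕ}
    {Λ : Submodule ℤ (EuclideanSpace ℝ (Fin d))} (hrat : IsRationalLattice d Λ)
    {v x : EuclideanSpace ℝ (Fin d)} (hv : v ∈ Λ) (hx : x ∈ Λ) :
    ∃ m : ℕ, m ≠ 0 ∧ m • reflectionOf d v x ∈ Λ := by
  obtain ⟨c, hc, h⟩ := hrat
  obtain ⟨p, hp⟩ := h v hv x hx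
  obtain ⟨q, hq⟩ := h v hv v hv
  set t : ℚ := 2 * (p / q) with ht
  have hcoef : 2 * (inner ℝ v x / inner ℝ v v) = (t : ℝ) := by
    rw [ht]
    push_cast
    rw [← hp, ← hq, mul_div_mul_left _ _ hc.ne']
  have hden : (t.den : ℝ) * (t : ℝ) = (t.num : ℝ) := by
    exact_mod_cast Rat.den_mul_eq_num t
  refine ⟨t.den, t.den_ne_zero, ?_⟩
  have key : t.den • reflectionOf d v x = t.den • x - t.num • v := by
    rw [reflectionOf_apply, hcoef, smul_sub, ← Nat.cast_smul_eq_nsmul ℝ t.den ((t : ℝ) • v),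
      smul_smul, hden, Int.cast_smul_eq_zsmul]
  rw [key]
  exact sub_mem (nsmul_mem hx _) (zsmul_mem hv _)

theorem IsLatticeIn.of_le {d : ℕ} {Λ Γ : Submodule ℤ (EuclideanSpace ℝ (Fin d))}
    (hΛ : IsLatticeIn d Λ) (hle : Γ ≤ Λ)
    (hspan : Submodule.span ℝ (Γ : Set (EuclideanSpace ℝ (Fin d))) = ⊤) : IsLatticeIn d Γ := by
  obtain ⟨_, _⟩ := hΛ
  have : DiscreteTopology Γ := DiscreteTopology.of_subset (s := (Λ : Set _)) ‹_› hle
  exact ⟨this, ⟨hspan⟩⟩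

theorem reflectionOf_mem_coincidenceIsometries {d : ℕ}
    {Λ : Submodule ℤ (EuclideanSpace ℝ (Fin d))} (hΛ : IsLatticeIn d Λ)
    (hrat : IsRationalLattice d Λ) {v : EuclideanSpace ℝ (Fin d)} (hv : v ∈ Λ) :
    reflectionOf d v ∈ coincidenceIsometries d Λ := by
  refine hΛ.of_le inf_le_left ?_
  obtain ⟨_, hspan⟩ := hΛ
  rw [← top_le_iff, ← hspan.span_top, Submodule.span_le]
  intro x hx
  obtain ⟨m, hm, hmx⟩ := hrat.exists_smul_reflectionOf_mem hv hx
  -- Since `R_v` is an involution, `m • x` is the image of `m • R_v x ∈ Λ`.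
  have hmem : m • x ∈ coincidenceSite d Λ (reflectionOf d v) := by
    refine ⟨nsmul_mem hx m, m • reflectionOf d v x, hmx, ?_⟩
    change reflectionOf d v (m • reflectionOf d v x) = m • x
    rw [map_nsmul, reflectionOf_reflectionOf]
  have hm' : (m : ℝ) ≠ 0 := Nat.cast_ne_zero.mpr hm
  rw [SetLike.mem_coe, ← inv_smul_smul₀ hm' x, Nat.cast_smul_eq_nsmul]
  exact Submodule.smul_mem _ _ (Submodule.subset_span hmem)

/-- The off-diagonal part of the Gram form is at most `r²/(2d) (∑|a i|)²`, hence by Cauchy–Schwarz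
at most half of the diagonal part. -/
theorem norm_sq_sum_smul_ge {d : ℕ} {b : Fin d → EuclideanSpace ℝ (Fin d)} {r : ℝ}
    (hnorm : ∀ i, ‖b i‖ = r) (hinner : ∀ i j, i ≠ j → |inner ℝ (b i) (b j)| * (2 * d) ≤ r ^ 2)
    (a : Fin d → ℝ) : r ^ 2 * ∑ i, a i ^ 2 ≤ 2 * ‖∑ i, a i • b i‖ ^ 2 := by
  rcases Nat.eq_zero_or_pos d with rfl | hd
  · simp
  have hd' : (0 : ℝ) < d := Nat.cast_pos.mpr hd
  -- The error is subtracted on the diagonal too, so that it sums to a full square.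
  have hterm : ∀ i j, (if i = j then r ^ 2 * a i ^ 2 else 0) - r ^ 2 / (2 * d) * (|a i| * |a j|) ≤
      a i * (a j * inner ℝ (b i) (b j)) := by
    intro i j
    split_ifs with h
    · subst h
      rw [real_inner_self_eq_norm_sq, hnorm]
      have : 0 ≤ r ^ 2 / (2 * d) * (|a i| * |a i|) := by positivity
      nlinarith
    · have h1 : |inner ℝ (b i) (b j)| ≤ r ^ 2 / (2 * d) := by
        rw [le_div_iff₀ (by positivity)]
        exact hinner i j h
      have h2 : |a i * (a j * inner ℝ (b i) (b j))| ≤ r ^ 2 / (2 * d) * (|a i| * |a j|) := by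
        rw [← mul_assoc, abs_mul, abs_mul, mul_comm]
        gcongr
      linarith [neg_abs_le (a i * (a j * inner ℝ (b i) (b j)))]
  have hsum := Finset.sum_le_sum fun i (_ : i ∈ Finset.univ) =>
    Finset.sum_le_sum fun j (_ : j ∈ Finset.univ) => hterm i j
  have hright : ∑ i, ∑ j, a i * (a j * inner ℝ (b i) (b j)) = ‖∑ i, a i • b i‖ ^ 2 := by
    rw [← real_inner_self_eq_norm_sq, sum_inner]
    simp only [inner_sum, real_inner_smul_left, real_inner_smul_right]
    exact Finset.sum_congr rfl fun i _ => Finset.sum_congr rfl fun j _ => by ring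
  have hleft : ∑ i, ∑ j, ((if i = j then r ^ 2 * a i ^ 2 else 0) -
      r ^ 2 / (2 * d) * (|a i| * |a j|)) =
      r ^ 2 * ∑ i, a i ^ 2 - r ^ 2 / (2 * d) * (∑ i, |a i|) ^ 2 := by
    simp only [Finset.sum_sub_distrib, Finset.sum_ite_eq, Finset.mem_univ, if_true,
      ← Finset.mul_sum, sq (∑ i, |a i|), Finset.sum_mul_sum]
  have hcs : (∑ i, |a i|) ^ 2 ≤ d * ∑ i, a i ^ 2 := by
    simpa using sq_sum_le_card_mul_sum_sq (s := Finset.univ) (f := fun i => |a i|)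
  have hcs' : r ^ 2 / (2 * d) * (∑ i, |a i|) ^ 2 ≤ r ^ 2 / 2 * ∑ i, a i ^ 2 := by
    calc r ^ 2 / (2 * d) * (∑ i, |a i|) ^ 2 ≤ r ^ 2 / (2 * d) * (d * ∑ i, a i ^ 2) := by gcongr
      _ = r ^ 2 / 2 * ∑ i, a i ^ 2 := by field_simp
  rw [hright, hleft] at hsum
  linarith

theorem linearIndependent_of_almost_orthogonal {d : ℕ} {b : Fin d → EuclideanSpace ℝ (Fin d)}
    {r : ℝ} (hr : 0 < r) (hnorm : ∀ i, ‖b i‖ = r)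
    (hinner : ∀ i j, i ≠ j → |inner ℝ (b i) (b j)| * (2 * d) ≤ r ^ 2) :
    LinearIndependent ℝ b := by
  rw [Fintype.linearIndependent_iff]
  intro a ha i
  have h := norm_sq_sum_smul_ge hnorm hinner a
  rw [ha, norm_zero] at h
  have h1 : a i ^ 2 ≤ ∑ i, a i ^ 2 :=
    Finset.single_le_sum (f := fun i => a i ^ 2) (fun _ _ => sq_nonneg _) (Finset.mem_univ i)
  have h2 : ∑ i, a i ^ 2 ≤ 0 := by
    by_contra! h3
    have := mul_pos (pow_pos hr 2) h3
    linarith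
  exact pow_eq_zero_iff two_ne_zero |>.mp (le_antisymm (h1.trans h2) (sq_nonneg _))

/-- Two nonzero integer coefficients give `∑ a i ^ 2 ≥ 2`, which offsets the lost factor 2; a single
one is computed exactly. -/
theorem le_norm_sum_zsmul_of_almost_orthogonal {d : ℕ} {b : Fin d → EuclideanSpace ℝ (Fin d)}
    {r : ℝ} (hr : 0 < r) (hnorm : ∀ i, ‖b i‖ = r)
    (hinner : ∀ i j, i ≠ j → |inner ℝ (b i) (b j)| * (2 * d) ≤ r ^ 2)
    {a : Fin d → ℤ} (ha : a ≠ 0) : r ≤ ‖∑ i, a i • b i‖ := by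
  have hone : ∀ i, a i ≠ 0 → (1 : ℝ) ≤ |(a i : ℝ)| := fun i hi => by
    exact_mod_cast Int.one_le_abs hi
  obtain ⟨i, hi⟩ := Function.ne_iff.mp ha
  by_cases h : ∃ j, j ≠ i ∧ a j ≠ 0
  · obtain ⟨j, hji, hj⟩ := h
    have hsum : (2 : ℝ) ≤ ∑ k, (a k : ℝ) ^ 2 := by
      have hpair : ∑ k ∈ {i, j}, (a k : ℝ) ^ 2 ≤ ∑ k, (a k : ℝ) ^ 2 :=
        Finset.sum_le_sum_of_subset_of_nonneg (Finset.subset_univ _) fun _ _ _ => sq_nonneg _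
      rw [Finset.sum_pair hji.symm] at hpair
      have h1 := one_le_sq_iff_one_le_abs (a i : ℝ) |>.mpr (hone i hi)
      have h2 := one_le_sq_iff_one_le_abs (a j : ℝ) |>.mpr (hone j hj)
      linarith
    have hge := norm_sq_sum_smul_ge hnorm hinner (fun k => (a k : ℝ))
    simp only [Int.cast_smul_eq_zsmul] at hge
    have := mul_le_mul_of_nonneg_left hsum (sq_nonneg r)
    exact (sq_le_sq₀ hr.le (norm_nonneg _)).mp (by linarith)
  · push Not at h
    rw [Finset.sum_eq_single i (fun j _ hj => by rw [h j hj, zero_smul]) (by simp),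
      ← Int.cast_smul_eq_zsmul ℝ, norm_smul, hnorm, Real.norm_eq_abs]
    exact le_mul_of_one_le_left hr.le (hone i hi)

theorem isWellRounded_span_of_almost_orthogonal {d : ℕ} {b : Fin d → EuclideanSpace ℝ (Fin d)}
    {r : ℝ} (hr : 0 < r) (hnorm : ∀ i, ‖b i‖ = r)
    (hinner : ∀ i j, i ≠ j → |inner ℝ (b i) (b j)| * (2 * d) ≤ r ^ 2) :
    IsWellRounded d (Submodule.span ℤ (Set.range b)) := by
  have hli := linearIndependent_of_almost_orthogonal hr hnorm hinner
  rw [IsWellRounded, ← top_le_iff, ← hli.span_eq_top_of_card_eq_finrank' (by simp)]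
  apply Submodule.span_mono
  rintro _ ⟨i, rfl⟩
  refine ⟨Submodule.subset_span ⟨i, rfl⟩, hli.ne_zero i, fun w hw hw0 => ?_⟩
  obtain ⟨a, rfl⟩ := (Submodule.mem_span_range_iff_exists_fun ℤ).mp hw
  rw [hnorm]
  refine le_norm_sum_zsmul_of_almost_orthogonal hr hnorm hinner ?_
  rintro rfl
  simp at hw0

open Filter Topology in
theorem exists_reflectionOf_almost_orthogonal {d : ℕ}
    {Λ : Submodule ℤ (EuclideanSpace ℝ (Fin d))} (hΛ : IsLatticeIn d Λ)
    {v : EuclideanSpace ℝ (Fin d)} (hv : v ≠ 0) {ε : ℝ} (hε : 0 < ε) :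
    ∃ w : Fin d → EuclideanSpace ℝ (Fin d), (∀ i, w i ∈ Λ) ∧
      ∀ i j, i ≠ j → |inner ℝ (reflectionOf d (w i) v) (reflectionOf d (w j) v)| < ε := by
  let e := EuclideanSpace.basisFun (Fin d) ℝ
  have hex : ∀ i, ∃ y ≠ 0, reflectionOf d y v = ‖v‖ • e i ∨ reflectionOf d y v = -(‖v‖ • e i) :=
    fun i => exists_reflectionOf_eq_or_neg hv (by simp [norm_smul])
  choose y hy0 hy using hex
  choose l hl hlim using fun i => exists_tendsto_reflectionOf hΛ (hy0 i) v
  have horth : ∀ i j, i ≠ j → inner ℝ (reflectionOf d (y i) v) (reflectionOf d (y j) v) = 0 := by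
    intro i j hij
    have := e.orthonormal.2 hij
    rcases hy i with h | h <;> rcases hy j with h' | h' <;>
      simp [h, h', real_inner_smul_left, real_inner_smul_right, this]
  have hev : ∀ᶠ n in atTop, ∀ i j, i ≠ j →
      |inner ℝ (reflectionOf d (l i n) v) (reflectionOf d (l j n) v)| < ε := by
    simp only [eventually_all]
    intro i j hij
    have := ((hlim i).inner (𝕜 := ℝ) (hlim j)).abs
    rw [horth i j hij, abs_zero] at this
    exact this.eventually_lt_const hε
  obtain ⟨n, hn⟩ := hev.exists
  exact ⟨fun i => l i n, fun i => hl i n, hn⟩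

theorem exists_wellRounded_sublattice {d : ℕ}
    {Λ : Submodule ℤ (EuclideanSpace ℝ (Fin d))} (hΛ : IsLatticeIn d Λ)
    (hrat : IsRationalLattice d Λ) :
    ∃ Γ : Submodule ℤ (EuclideanSpace ℝ (Fin d)),
      Γ ≤ Λ ∧ IsLatticeIn d Γ ∧ IsWellRounded d Γ := by
  rcases Nat.eq_zero_or_pos d with rfl | hd
  · exact ⟨Λ, le_rfl, hΛ, Subsingleton.elim _ _⟩
  have hd' : (0 : ℝ) < d := Nat.cast_pos.mpr hd
  obtain ⟨v, hvΛ, hv⟩ : ∃ v ∈ Λ, v ≠ 0 := by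
    rw [← Submodule.ne_bot_iff]
    rintro rfl
    obtain ⟨_, h⟩ := hΛ
    have : Nonempty (Fin d) := ⟨⟨0, hd⟩⟩
    have htop := h.span_top
    simp at htop
  have hv' : 0 < ‖v‖ := norm_pos_iff.mpr hv
  obtain ⟨w, hw, hinner⟩ := exists_reflectionOf_almost_orthogonal hΛ hv
    (ε := ‖v‖ ^ 2 / (2 * d)) (by positivity)
  choose m hm hmem using fun i => hrat.exists_smul_reflectionOf_mem (hw i) hvΛ
  -- A single multiplier for all `i` keeps the lengths equal.
  let M := ∏ i, m i
  have hM : (0 : ℝ) < M := Nat.cast_pos.mpr (Nat.pos_of_ne_zero (Finset.prod_ne_zero_iff.mpr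
    fun i _ => hm i))
  let b : Fin d → EuclideanSpace ℝ (Fin d) := fun i => (M : ℝ) • reflectionOf d (w i) v
  have hbΛ : ∀ i, b i ∈ Λ := by
    intro i
    obtain ⟨k, hk⟩ : m i ∣ M := Finset.dvd_prod_of_mem m (Finset.mem_univ i)
    change (M : ℝ) • _ ∈ Λ
    rw [Nat.cast_smul_eq_nsmul, hk, mul_comm, mul_smul]
    exact nsmul_mem (hmem i) k
  have hr : 0 < (M : ℝ) * ‖v‖ := mul_pos hM hv'
  have hnorm : ∀ i, ‖b i‖ = M * ‖v‖ := fun i => by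
    simp only [b, norm_smul, LinearIsometryEquiv.norm_map, Real.norm_natCast]
  have hb : ∀ i j, i ≠ j → |inner ℝ (b i) (b j)| * (2 * d) ≤ (M * ‖v‖) ^ 2 := by
    intro i j hij
    have h := ((lt_div_iff₀ (by positivity)).mp (hinner i j hij)).le
    simp only [b, real_inner_smul_left, real_inner_smul_right, abs_mul, abs_of_pos hM]
    calc _ = (M : ℝ) ^ 2 * (|inner ℝ (reflectionOf d (w i) v) (reflectionOf d (w j) v)| *
            (2 * d)) := by ring
      _ ≤ (M : ℝ) ^ 2 * ‖v‖ ^ 2 := by gcongr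
      _ = _ := by ring
  have hle : Submodule.span ℤ (Set.range b) ≤ Λ :=
    Submodule.span_le.mpr (Set.range_subset_iff.mpr hbΛ)
  have hwr := isWellRounded_span_of_almost_orthogonal hr hnorm hb
  refine ⟨_, hle, hΛ.of_le hle ?_, hwr⟩
  rw [← top_le_iff, ← show _ = _ from hwr]
  exact Submodule.span_mono fun x hx => hx.1

theorem mainTheorem3 (d : ℕ) (Λ : Submodule ℤ (EuclideanSpace ℝ (Fin d)))
    (hΛ : IsLatticeIn d Λ) (hrat : IsRationalLattice d Λ) :
    (∃ Γ : Submodule ℤ (EuclideanSpace ℝ (Fin d)),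
      Γ ≤ Λ ∧ IsLatticeIn d Γ ∧ IsWellRounded d Γ) ∧
    (∀ v ∈ Λ, v ≠ 0 → reflectionOf d v ∈ coincidenceIsometries d Λ) :=
  ⟨exists_wellRounded_sublattice hΛ hrat,
    fun _ hv _ => reflectionOf_mem_coincidenceIsometries hΛ hrat hv⟩
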